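/- Let $\mathfrak H$ be a separable complex Hilbert space, let $\Omega$ be a measurable space, and let $\{S_\omega\}_{\omega\in\Omega}$ be a family of (possibly unbounded) self-adjoint operators in $\mathfrak H$. For each $\omega$ let $(E_\omega(\lambda))_{\lambda\in\mathbb R}$ be the resolution of the identity of $S_\omega$, that is, the strongly right-continuous family of orthogonal projections with $E_\omega(\lambda)E_\omega(\mu)=E_\omega(\min\{\lambda,\mu\})$, with $E_\omega(\lambda)\to 0$ strongly as $\lambda\to-\infty$ and $E_\omega(\lambda)\to I$ strongly as $\lambda\to+\infty$, and with $S_\omega=\int_{\mathbb R}\lambda\,dE_\omega(\lambda)$; the last condition means that the domain of $S_\omega$ is $\{\psi:\int\lambda^2\,d\langle\psi,E_\omega(\lambda)\psi\rangle<\infty\}$ and that $\langle\psi,S_\omega\psi\rangle=\int\lambda\,d\langle\psi,E_\omega(\lambda)\psi\rangle$ for all $\psi$ in this domain. Suppose that the family is measurable, i.e. that for all $\varphi,\psi\in\mathfrak H$ and all $\lambda\in\mathbb R$ the map $\omega\mapsto\langle\varphi,E_\omega(\lambda)\psi\rangle$ is measurable. Then for every $E\in\mathbb R$ the set $$A(E)=\{\omega\in\Omega: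 E\in\sigma_p(S_\omega)\}$$ is measurable, where $\sigma_p(S_\omega)$ is the set of eigenvalues of $S_\omega$, that is, of those $z\in\mathbb C$ for which there is a nonzero $\psi$ in the domain of $S_\omega$ with $S_\omega\psi=z\psi$. -/

import Mathlib

open scoped InnerProductSpace

noncomputable section

/-- A resolution of the identity (spectral family) on a Hilbert space `H`: a family
`(E(t))_{t ∈ ℝ}` of orthogonal projections with `E(s) E(t) = E(min s t)`, strongly continuous from
the right, with strong limits `0` at `-∞` and `1` at `+∞`. -/
structure ResolutionOfIdentity (H : Type*) [NormedAddCommGroup H] [InnerProductSpace ℂ H]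
    [CompleteSpace H] where
  /-- The projection `E(t)`; it plays the role of `E((-∞, t])`. -/
  proj : ℝ → H →L[ℂ] H
  isStarProjection : ∀ t, IsStarProjection (proj t)
  proj_mul_proj : ∀ s t, proj s * proj t = proj (min s t)
  right_continuous : ∀ (ψ : H) (t : ℝ), ContinuousWithinAt (fun s => proj s ψ) (Set.Ici t) t
  tendsto_atBot : ∀ ψ : H, Filter.Tendsto (fun t => proj t ψ) Filter.atBot (nhds 0)
  tendsto_atTop : ∀ ψ : H, Filter.Tendsto (fun t => proj t ψ) Filter.atTop (nhds ψ)

namespace ResolutionOfIdentity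

variable {H : Type*} [NormedAddCommGroup H] [InnerProductSpace ℂ H] [CompleteSpace H]

theorem norm_proj_apply_le (E : ResolutionOfIdentity H) (t : ℝ) (ψ : H) :
    ‖E.proj t ψ‖ ≤ ‖ψ‖ := by
  have h := E.isStarProjection t
  have h1 : ‖E.proj t ψ‖ ^ 2 ≤ ‖E.proj t ψ‖ * ‖ψ‖ := by
    have e : (⟪E.proj t ψ, E.proj t ψ⟫_ℂ) = ⟪E.proj t ψ, ψ⟫_ℂ := by
      have hsa : ContinuousLinearMap.adjoint (E.proj t) = E.proj t := h.isSelfAdjoint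
      rw [← ContinuousLinearMap.adjoint_inner_left, hsa, ← mul_apply_eq_comp,
        h.isIdempotentElem.eq]
    calc ‖E.proj t ψ‖ ^ 2 = ‖⟪E.proj t ψ, E.proj t ψ⟫_ℂ‖ := by
          rw [inner_self_eq_norm_sq_to_K]; simp
      _ = ‖⟪E.proj t ψ, ψ⟫_ℂ‖ := by rw [e]
      _ ≤ _ := norm_inner_le_norm _ _
  by_contra! hlt
  have h0 : 0 < ‖E.proj t ψ‖ := (norm_nonneg ψ).trans_lt hlt
  nlinarith

/-- The distribution function `t ↦ ‖E(t) ψ‖² = ⟨ψ, E(t) ψ⟩`. -/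
def stieltjes (E : ResolutionOfIdentity H) (ψ : H) : StieltjesFunction ℝ where
  toFun t := ‖E.proj t ψ‖ ^ 2
  mono' := fun s t hst => by
    have h : E.proj s ψ = E.proj s (E.proj t ψ) := by
      rw [← mul_apply_eq_comp, E.proj_mul_proj, min_eq_left hst]
    have h2 : ‖E.proj s ψ‖ ≤ ‖E.proj t ψ‖ := by
      rw [h]; exact E.norm_proj_apply_le s _
    exact pow_le_pow_left₀ (norm_nonneg _) h2 2
  right_continuous' := fun t => ((E.right_continuous ψ t).norm).pow 2

/-- The spectral measure `d⟨ψ, E(t) ψ⟩` on `ℝ`: the Lebesgue-Stieltjes measure of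
`t ↦ ⟨ψ, E(t) ψ⟩`. -/
def measure (E : ResolutionOfIdentity H) (ψ : H) : MeasureTheory.Measure ℝ :=
  (E.stieltjes ψ).measure

/-- `E` is the resolution of the identity of the operator `S`, i.e. `S = ∫ t dE(t)`: the domain of
`S` consists of the `ψ` with `∫ t² d⟨ψ, E(t) ψ⟩ < ∞`, and `⟨ψ, S ψ⟩ = ∫ t d⟨ψ, E(t) ψ⟩` for such `ψ`
(which determines `S ψ` by polarization). -/
structure IsResolutionOf (E : ResolutionOfIdentity H) (S : H →ₗ.[ℂ] H) : Prop where
  mem_domain_iff : ∀ ψ : H, ψ ∈ S.domain ↔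
    MeasureTheory.Integrable (fun t : ℝ => t ^ 2) (E.measure ψ)
  inner_apply : ∀ ψ : S.domain,
    ⟪(ψ : H), S ψ⟫_ℂ = ((∫ t : ℝ, t ∂(E.measure (ψ : H)) : ℝ) : ℂ)

end ResolutionOfIdentity

/-- A family `(S_ω)` of operators is measurable if `ω ↦ ⟨φ, E_ω(t) ψ⟩` is measurable for all `t`,
`φ`, `ψ`, where `E_ω` is the resolution of the identity of `S_ω`. -/
def IsMeasurableFamily {Ω H : Type*} [MeasurableSpace Ω] [NormedAddCommGroup H]
    [InnerProductSpace ℂ H] [CompleteSpace H] (S : Ω → H →ₗ.[ℂ] H) : Prop :=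
  ∃ E : Ω → ResolutionOfIdentity H, (∀ ω, (E ω).IsResolutionOf (S ω)) ∧
    ∀ (t : ℝ) (φ ψ : H), Measurable fun ω => ⟪φ, (E ω).proj t ψ⟫_ℂ

/-- The point spectrum `σ_p(S)`: the set of eigenvalues of a partially defined operator `S`. -/
def pointSpectrum {H : Type*} [NormedAddCommGroup H] [InnerProductSpace ℂ H]
    (S : H →ₗ.[ℂ] H) : Set ℂ :=
  {z | ∃ ψ : S.domain, (ψ : H) ≠ 0 ∧ S ψ = z • (ψ : H)}

end

/-!
A real number `e` is an eigenvalue of a self-adjoint operator exactly if its spectral family `E`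
jumps at `e`, and whether a jump occurs can be tested on a countable dense set of vectors by means
of the functions `ω ↦ ‖E_ω(t) φ‖² = ⟨φ, E_ω(t) φ⟩`, which are measurable by assumption.

The operator is known only through its domain and its quadratic form, so the first equivalence
(`IsResolutionOf.mem_pointSpectrum_iff`) is proved by polarization, with
`⟨ψ, (S - e) ψ⟩ = ∫ (t - e) d⟨ψ, E(t) ψ⟩`. A vector is called concentrated at `e` if `E(t)` fixes it
for `t ≥ e` and kills it for `t < e`.

* Let `S ψ = e ψ`. The pieces `E(a) ψ` and `ψ - E(a) ψ` have mutually orthogonal cyclic subspaces,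
  so spectral measures are additive on them and `S - e` does not couple them. Hence
  `∫ (t - e) d⟨ψ, E(t) ψ⟩` vanishes on `(-∞, a]` and on `(a, ∞)`. Since `t - e` has a strict sign on
  the one of these that avoids `e`, the corresponding piece of `ψ` is zero, and `ψ` is concentrated
  at `e` (`IsResolutionOf.isConcentratedAt_of_apply_eq`).
* Let `w` be concentrated at `e`. The spectral measures of `φ` and `φ + w` differ only by a
  multiple of the Dirac mass at `e`, where `t - e` vanishes. So the form of `S - e` takes the same
  value at `φ` and `φ + w`; by polarization `(S - e) w` is orthogonal to the dense domain of `S`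
  (`IsConcentratedAt.apply_eq`).

Finally `exists_isConcentratedAt_iff` says that a nonzero concentrated vector exists exactly if, for
some `φ` in a dense sequence, `‖E(s) φ‖²` does not tend to `‖E(e) φ‖²` as `s` increases to `e`: the
vector `E(e) φ - lim E(s) φ` is concentrated at `e`, and conversely the operators `E(e) - E(s)` fix a
concentrated vector and are uniformly bounded.
-/

namespace ResolutionOfIdentity

open MeasureTheory Filter Topology

/-! ### Polarization -/

section Polarization

variable {H : Type*} [NormedAddCommGroup H] [InnerProductSpace ℂ H]

/-- Polarization: a sesquilinear form vanishes at `(u, v)` if its quadratic form is additive on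
`(u, v)` and on `(u, i v)`. -/
theorem inner_eq_zero_of_quadratic_add {D : Submodule ℂ H} (T : D →ₗ[ℂ] H) (u v : D)
    (h1 : ⟪((u + v : D) : H), T (u + v)⟫_ℂ = ⟪(u : H), T u⟫_ℂ + ⟪(v : H), T v⟫_ℂ)
    (h2 : ⟪((u + Complex.I • v : D) : H), T (u + Complex.I • v)⟫_ℂ =
      ⟪(u : H), T u⟫_ℂ + ⟪((Complex.I • v : D) : H), T (Complex.I • v)⟫_ℂ) :
    ⟪(u : H), T v⟫_ℂ = 0 := by
  simp only [map_add, map_smul, Submodule.coe_add, Submodule.coe_smul, inner_add_left,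
    inner_add_right, inner_smul_left, inner_smul_right, Complex.conj_I] at h1 h2
  linear_combination (1 / 2) * h1 - (Complex.I / 2) * h2 +
    (1 / 2) * (⟪(u : H), T v⟫_ℂ - ⟪(v : H), T u⟫_ℂ) * Complex.I_sq

/-- The operator `S - e` on the domain of `S`. -/
def shift (S : H →ₗ.[ℂ] H) (e : ℝ) : S.domain →ₗ[ℂ] H :=
  S.toFun - (e : ℂ) • S.domain.subtype

theorem shift_apply (S : H →ₗ.[ℂ] H) (e : ℝ) (ψ : S.domain) :
    shift S e ψ = S ψ - (e : ℂ) • (ψ : H) := rfl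

end Polarization

variable {H : Type*} [NormedAddCommGroup H] [InnerProductSpace ℂ H] [CompleteSpace H]

/-! ### Algebra of spectral projections -/

theorem proj_proj (E : ResolutionOfIdentity H) (s t : ℝ) (ψ : H) :
    E.proj s (E.proj t ψ) = E.proj (min s t) ψ := by
  rw [← E.proj_mul_proj]; rfl

theorem inner_proj_left (E : ResolutionOfIdentity H) (t : ℝ) (φ ψ : H) :
    ⟪E.proj t φ, ψ⟫_ℂ = ⟪φ, E.proj t ψ⟫_ℂ := by
  have hsa : ContinuousLinearMap.adjoint (E.proj t) = E.proj t :=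
    (E.isStarProjection t).isSelfAdjoint
  rw [← ContinuousLinearMap.adjoint_inner_right, hsa]

theorem inner_proj_proj (E : ResolutionOfIdentity H) (t : ℝ) (φ ψ : H) :
    ⟪E.proj t φ, E.proj t ψ⟫_ℂ = ⟪φ, E.proj t ψ⟫_ℂ := by
  rw [inner_proj_left, proj_proj, min_self]

theorem norm_proj_sq (E : ResolutionOfIdentity H) (t : ℝ) (ψ : H) :
    ‖E.proj t ψ‖ ^ 2 = RCLike.re ⟪ψ, E.proj t ψ⟫_ℂ := by
  rw [← inner_proj_proj, norm_sq_eq_re_inner (𝕜 := ℂ)]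

theorem norm_proj_sub_proj_sq (E : ResolutionOfIdentity H) {s t : ℝ} (hst : s ≤ t) (ψ : H) :
    ‖E.proj t ψ - E.proj s ψ‖ ^ 2 = ‖E.proj t ψ‖ ^ 2 - ‖E.proj s ψ‖ ^ 2 := by
  have h : RCLike.re ⟪E.proj t ψ, E.proj s ψ⟫_ℂ = ‖E.proj s ψ‖ ^ 2 := by
    rw [inner_proj_left, proj_proj, min_eq_right hst, norm_proj_sq]
  rw [norm_sub_sq (𝕜 := ℂ), h]
  ring

/-! ### Spectral measures -/

theorem measure_Iic (E : ResolutionOfIdentity H) (ψ : H) (t : ℝ) :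
    E.measure ψ (Set.Iic t) = ENNReal.ofReal (‖E.proj t ψ‖ ^ 2) := by
  have h : Tendsto (E.stieltjes ψ) atBot (𝓝 0) := by
    have h0 := (E.tendsto_atBot ψ).norm.pow 2
    rw [norm_zero, zero_pow two_ne_zero] at h0
    exact h0
  rw [measure, StieltjesFunction.measure_Iic _ h, sub_zero]
  rfl

theorem measure_univ (E : ResolutionOfIdentity H) (ψ : H) :
    E.measure ψ Set.univ = ENNReal.ofReal (‖ψ‖ ^ 2) := by
  have h : Tendsto (E.stieltjes ψ) atBot (𝓝 0) := by
    have h0 := (E.tendsto_atBot ψ).norm.pow 2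
    rw [norm_zero, zero_pow two_ne_zero] at h0
    exact h0
  have h' : Tendsto (E.stieltjes ψ) atTop (𝓝 (‖ψ‖ ^ 2)) := (E.tendsto_atTop ψ).norm.pow 2
  rw [measure, StieltjesFunction.measure_univ _ h h', sub_zero]

instance isFiniteMeasure_measure (E : ResolutionOfIdentity H) (ψ : H) :
    IsFiniteMeasure (E.measure ψ) :=
  ⟨by rw [measure_univ]; exact ENNReal.ofReal_lt_top⟩

theorem measure_real_univ (E : ResolutionOfIdentity H) (ψ : H) :
    (E.measure ψ).real Set.univ = ‖ψ‖ ^ 2 := by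
  rw [measureReal_def, measure_univ, ENNReal.toReal_ofReal (by positivity)]

/-- Spectral measures are additive on pairs of vectors whose cyclic subspaces are orthogonal. -/
theorem measure_add_of_inner_eq_zero (E : ResolutionOfIdentity H) {φ χ : H}
    (h : ∀ t, ⟪φ, E.proj t χ⟫_ℂ = 0) : E.measure (φ + χ) = E.measure φ + E.measure χ := by
  refine Measure.ext_of_Iic _ _ fun t => ?_
  rw [Measure.add_apply, measure_Iic, measure_Iic, measure_Iic,
    ← ENNReal.ofReal_add (by positivity) (by positivity), map_add, norm_add_sq (𝕜 := ℂ),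
    inner_proj_proj, h]
  simp

theorem measure_proj (E : ResolutionOfIdentity H) (a : ℝ) (ψ : H) :
    E.measure (E.proj a ψ) = (E.measure ψ).restrict (Set.Iic a) := by
  refine Measure.ext_of_Iic _ _ fun t => ?_
  rw [Measure.restrict_apply measurableSet_Iic, Set.Iic_inter_Iic, measure_Iic, measure_Iic,
    proj_proj]

theorem inner_sub_proj_proj (E : ResolutionOfIdentity H) (a t : ℝ) (ψ : H) :
    ⟪ψ - E.proj a ψ, E.proj t (E.proj a ψ)⟫_ℂ = 0 := by
  rw [inner_sub_left, inner_proj_left, proj_proj, proj_proj, min_comm t a, ← min_assoc, min_self,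
    sub_self]

theorem measure_sub_proj (E : ResolutionOfIdentity H) (a : ℝ) (ψ : H) :
    E.measure (ψ - E.proj a ψ) = (E.measure ψ).restrict (Set.Ioi a) := by
  have h := E.measure_add_of_inner_eq_zero fun t => E.inner_sub_proj_proj a t ψ
  rw [sub_add_cancel, measure_proj] at h
  have h' := Measure.restrict_add_restrict_compl (μ := E.measure ψ)
    (measurableSet_Iic (a := a))
  rw [Set.compl_Iic, add_comm] at h'
  have h'' := h'.trans h
  refine Measure.ext fun A _ => ?_
  have hA := congrArg (fun μ : Measure ℝ => μ A) h''
  simp only [Measure.add_apply] at hA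
  exact ((ENNReal.add_left_inj (measure_ne_top _ A)).1 hA).symm

theorem integrable_id_of_sq {μ : Measure ℝ} [IsFiniteMeasure μ]
    (h : Integrable (fun t : ℝ => t ^ 2) μ) : Integrable (fun t : ℝ => t) μ := by
  refine (h.add (integrable_const 1)).mono' measurable_id.aestronglyMeasurable
    (ae_of_all _ fun t => ?_)
  simp only [Real.norm_eq_abs, Pi.add_apply]
  nlinarith [sq_abs t, sq_nonneg (|t| - 1), abs_nonneg t]

/-! ### The quadratic form of `S - e` -/

variable {E : ResolutionOfIdentity H} {S : H →ₗ.[ℂ] H}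

theorem IsResolutionOf.integrable_id (hE : E.IsResolutionOf S) (ψ : S.domain) :
    Integrable (fun t : ℝ => t) (E.measure (ψ : H)) :=
  integrable_id_of_sq ((hE.mem_domain_iff ψ).1 ψ.2)

theorem IsResolutionOf.integrable_sub (hE : E.IsResolutionOf S) (e : ℝ) (ψ : S.domain) :
    Integrable (fun t : ℝ => t - e) (E.measure (ψ : H)) :=
  (hE.integrable_id ψ).sub (integrable_const e)

theorem IsResolutionOf.inner_shift (hE : E.IsResolutionOf S) (e : ℝ) (ψ : S.domain) :
    ⟪(ψ : H), shift S e ψ⟫_ℂ = ((∫ t, (t - e) ∂(E.measure (ψ : H)) : ℝ) : ℂ) := by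
  rw [shift_apply, inner_sub_right, hE.inner_apply, inner_smul_right,
    integral_sub (hE.integrable_id ψ) (integrable_const e), integral_const, measure_real_univ,
    inner_self_eq_norm_sq_to_K]
  push_cast [smul_eq_mul]
  simp [mul_comm]

/-- The operator `S - e` does not couple vectors whose cyclic subspaces are orthogonal. -/
theorem IsResolutionOf.inner_shift_eq_zero (hE : E.IsResolutionOf S) (e : ℝ) (u v : S.domain)
    (h : ∀ t, ⟪(u : H), E.proj t v⟫_ℂ = 0) : ⟪(u : H), shift S e v⟫_ℂ = 0 := by
  have key : ∀ w : S.domain, (∀ t, ⟪(u : H), E.proj t w⟫_ℂ = 0) →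
      ⟪((u + w : S.domain) : H), shift S e (u + w)⟫_ℂ =
        ⟪(u : H), shift S e u⟫_ℂ + ⟪(w : H), shift S e w⟫_ℂ := by
    intro w hw
    rw [hE.inner_shift, hE.inner_shift, hE.inner_shift, Submodule.coe_add,
      E.measure_add_of_inner_eq_zero hw,
      integral_add_measure (hE.integrable_sub e u) (hE.integrable_sub e w)]
    push_cast
    rfl
  refine inner_eq_zero_of_quadratic_add _ u v (key v h) (key _ fun t => ?_)
  simp [h t]

theorem IsResolutionOf.proj_mem_domain (hE : E.IsResolutionOf S) (a : ℝ) (ψ : S.domain) :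
    E.proj a (ψ : H) ∈ S.domain := by
  rw [hE.mem_domain_iff, measure_proj]
  exact ((hE.mem_domain_iff ψ).1 ψ.2).restrict

/-! ### Eigenvectors and jumps of the spectral family -/

/-- `ψ` is concentrated at `e`: it is fixed by `E(t)` for `t ≥ e` and killed for `t < e`, i.e. it
lies in the range of the jump of the spectral family at `e`. -/
def IsConcentratedAt (E : ResolutionOfIdentity H) (e : ℝ) (ψ : H) : Prop :=
  (∀ t, e ≤ t → E.proj t ψ = ψ) ∧ ∀ t, t < e → E.proj t ψ = 0

/-- Eigenvectors are concentrated at their eigenvalue: the form of `S - e` vanishes on both pieces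
of an eigenvector cut at `a ≠ e`, and is definite on the piece away from `e`. -/
theorem IsResolutionOf.isConcentratedAt_of_apply_eq (hE : E.IsResolutionOf S) {e : ℝ}
    {ψ : S.domain} (hψ : S ψ = (e : ℂ) • (ψ : H)) : E.IsConcentratedAt e (ψ : H) := by
  have hT : shift S e ψ = 0 := by rw [shift_apply, hψ, sub_self]
  have hzero : ∀ a : ℝ, (∫ t in Set.Ioi a, (t - e) ∂(E.measure (ψ : H)) = 0) ∧
      ∫ t in Set.Iic a, (t - e) ∂(E.measure (ψ : H)) = 0 := by
    intro a
    let χ : S.domain := ⟨E.proj a ψ, hE.proj_mem_domain a ψ⟩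
    have hχ : (χ : H) = E.proj a ψ := rfl
    have hφ : ((ψ - χ : S.domain) : H) = ψ - E.proj a ψ := rfl
    have h1 : ⟪((ψ - χ : S.domain) : H), shift S e χ⟫_ℂ = 0 :=
      hE.inner_shift_eq_zero e _ _ fun t => E.inner_sub_proj_proj a t ψ
    have h2 : ⟪(χ : H), shift S e (ψ - χ)⟫_ℂ = 0 := by
      refine hE.inner_shift_eq_zero e _ _ fun t => ?_
      rw [hφ, hχ, ← inner_proj_left, ← inner_conj_symm, E.inner_sub_proj_proj, map_zero]
    constructor
    · have h3 := hE.inner_shift e (ψ - χ)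
      rw [map_sub, hT, inner_sub_right, h1, inner_zero_right, sub_zero, hφ,
        measure_sub_proj] at h3
      exact_mod_cast h3.symm
    · have h3 := hE.inner_shift e χ
      rw [map_sub, hT, zero_sub, inner_neg_right, neg_eq_zero] at h2
      rw [h2, hχ, measure_proj] at h3
      exact_mod_cast h3.symm
  have hint := hE.integrable_sub e ψ
  -- On `(a, ∞)` with `a > e` the integrand is at least `a - e > 0`.
  have hgt : ∀ a, e < a → E.proj a (ψ : H) = ψ := by
    intro a ha
    have hle : (a - e) * ‖(ψ : H) - E.proj a ψ‖ ^ 2 ≤ 0 := by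
      rw [← (hzero a).1, ← measure_real_univ, measure_sub_proj, mul_comm, ← smul_eq_mul,
        ← integral_const]
      exact setIntegral_mono_on (integrable_const _) hint.integrableOn measurableSet_Ioi
        fun t ht => by linarith [Set.mem_Ioi.1 ht]
    have : ‖(ψ : H) - E.proj a ψ‖ ^ 2 = 0 := by
      nlinarith [sq_nonneg ‖(ψ : H) - E.proj a ψ‖, sub_pos.2 ha]
    rw [sq_eq_zero_iff, norm_eq_zero, sub_eq_zero] at this
    exact this.symm
  refine ⟨fun t ht => ?_, fun a ha => ?_⟩
  · rcases ht.eq_or_lt with rfl | ht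
    · have h1 : Tendsto (fun s => E.proj s (ψ : H)) (𝓝[>] e) (𝓝 (E.proj e ψ)) :=
        (E.right_continuous ψ e).mono_left (nhdsWithin_mono _ Set.Ioi_subset_Ici_self)
      refine tendsto_nhds_unique (h1.congr' ?_) tendsto_const_nhds
      filter_upwards [self_mem_nhdsWithin] with s hs using hgt s hs
    · exact hgt t ht
  · have hle : 0 ≤ (a - e) * ‖E.proj a (ψ : H)‖ ^ 2 := by
      rw [← (hzero a).2, ← measure_real_univ, measure_proj, mul_comm, ← smul_eq_mul,
        ← integral_const]
      exact setIntegral_mono_on hint.integrableOn (integrable_const _) measurableSet_Iic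
        fun t ht => by linarith [Set.mem_Iic.1 ht]
    have : ‖E.proj a (ψ : H)‖ ^ 2 = 0 := by
      nlinarith [sq_nonneg ‖E.proj a (ψ : H)‖, sub_neg.2 ha]
    simpa using this

theorem IsConcentratedAt.smul {e : ℝ} {w : H} (h : E.IsConcentratedAt e w) (c : ℂ) :
    E.IsConcentratedAt e (c • w) :=
  ⟨fun t ht => by rw [map_smul, h.1 t ht], fun t ht => by rw [map_smul, h.2 t ht, smul_zero]⟩

/-- Adding a vector concentrated at `e` changes the spectral measure only by an atom at `e`. The
hypothesis `hc` says that mass is added, not removed. -/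
theorem IsConcentratedAt.measure_add {e : ℝ} {w : H} (hw : E.IsConcentratedAt e w) (φ : H)
    (hc : 0 ≤ 2 * RCLike.re ⟪φ, w⟫_ℂ + ‖w‖ ^ 2) :
    E.measure (φ + w) = E.measure φ +
      ENNReal.ofReal (2 * RCLike.re ⟪φ, w⟫_ℂ + ‖w‖ ^ 2) • Measure.dirac e := by
  have := (Measure.dirac e).smul_finite
    (ENNReal.ofReal_ne_top (r := 2 * RCLike.re ⟪φ, w⟫_ℂ + ‖w‖ ^ 2))
  refine Measure.ext_of_Iic _ _ fun t => ?_
  rw [Measure.add_apply, Measure.smul_apply, measure_Iic, measure_Iic, map_add,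
    Measure.dirac_apply' _ measurableSet_Iic]
  rcases le_or_gt e t with ht | ht
  · rw [Set.indicator_of_mem (Set.mem_Iic.2 ht), Pi.one_apply, smul_eq_mul, mul_one,
      ← ENNReal.ofReal_add (by positivity) hc, norm_add_sq (𝕜 := ℂ), inner_proj_proj, hw.1 t ht,
      add_assoc]
  · rw [Set.indicator_of_notMem (by simpa using ht), hw.2 t ht]
    simp

/-- The quadratic form of `S - e` is invariant under adding vectors concentrated at `e`. -/
theorem IsConcentratedAt.integral_add {e : ℝ} {w : H} (hw : E.IsConcentratedAt e w) (φ : H)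
    (hφ : Integrable (fun t : ℝ => t - e) (E.measure φ))
    (hφw : Integrable (fun t : ℝ => t - e) (E.measure (φ + w))) :
    ∫ t, (t - e) ∂(E.measure (φ + w)) = ∫ t, (t - e) ∂(E.measure φ) := by
  have key : ∀ φ w : H, E.IsConcentratedAt e w → 0 ≤ 2 * RCLike.re ⟪φ, w⟫_ℂ + ‖w‖ ^ 2 →
      Integrable (fun t : ℝ => t - e) (E.measure φ) →
      ∫ t, (t - e) ∂(E.measure (φ + w)) = ∫ t, (t - e) ∂(E.measure φ) := by
    intro φ w hw hc hφ
    rw [hw.measure_add φ hc, integral_add_measure hφ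
      ((integrable_dirac (by simp)).smul_measure ENNReal.ofReal_ne_top),
      integral_smul_measure, integral_dirac]
    simp
  rcases le_total 0 (2 * RCLike.re ⟪φ, w⟫_ℂ + ‖w‖ ^ 2) with hc | hc
  · exact key φ w hw hc hφ
  -- For a negative mass, exchange the roles of `φ` and `φ + w`.
  · have hw' : E.IsConcentratedAt e (-w) := by simpa using hw.smul (-1)
    have h := key (φ + w) (-w) hw' ?_ hφw
    · rw [add_neg_cancel_right] at h
      exact h.symm
    · rw [inner_neg_right, inner_add_left, norm_neg, map_neg, map_add,
        ← norm_sq_eq_re_inner (𝕜 := ℂ)]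
      linarith

theorem IsConcentratedAt.mem_domain {e : ℝ} {w : H} (hw : E.IsConcentratedAt e w)
    (hE : E.IsResolutionOf S) : w ∈ S.domain := by
  rw [hE.mem_domain_iff]
  have h := hw.measure_add 0 (by simp)
  have h0 : E.measure (0 : H) = 0 := by
    rw [← Measure.measure_univ_eq_zero, measure_univ]; simp
  rw [zero_add, h0, zero_add] at h
  rw [h]
  exact (integrable_dirac (by simp)).smul_measure ENNReal.ofReal_ne_top

theorem IsConcentratedAt.apply_eq {e : ℝ} {w : S.domain} (hw : E.IsConcentratedAt e (w : H))
    (hE : E.IsResolutionOf S) (hdense : Dense (S.domain : Set H)) :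
    S w = (e : ℂ) • (w : H) := by
  have hadd : ∀ u v : S.domain, E.IsConcentratedAt e (v : H) →
      ⟪((u + v : S.domain) : H), shift S e (u + v)⟫_ℂ = ⟪(u : H), shift S e u⟫_ℂ := by
    intro u v hv
    rw [hE.inner_shift, hE.inner_shift, Submodule.coe_add,
      hv.integral_add _ (hE.integrable_sub e u) (hE.integrable_sub e (u + v))]
  have hself : ∀ v : S.domain, E.IsConcentratedAt e (v : H) →
      ⟪(v : H), shift S e v⟫_ℂ = 0 := by
    intro v hv
    simpa using hadd 0 v hv
  have hI : E.IsConcentratedAt e ((Complex.I • w : S.domain) : H) := hw.smul Complex.I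
  have hzero : shift S e w = 0 := by
    refine hdense.eq_zero_of_inner_right ℂ fun u hu => ?_
    exact inner_eq_zero_of_quadratic_add _ ⟨u, hu⟩ w (by rw [hadd _ w hw, hself w hw, add_zero])
      (by rw [hadd _ _ hI, hself _ hI, add_zero])
  rwa [shift_apply, sub_eq_zero] at hzero

theorem IsResolutionOf.mem_pointSpectrum_iff (hE : E.IsResolutionOf S)
    (hdense : Dense (S.domain : Set H)) (e : ℝ) :
    (e : ℂ) ∈ pointSpectrum S ↔ ∃ ψ : H, ψ ≠ 0 ∧ E.IsConcentratedAt e ψ :=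
  ⟨fun ⟨ψ, h0, h⟩ => ⟨ψ, h0, hE.isConcentratedAt_of_apply_eq h⟩,
    fun ⟨ψ, h0, h⟩ => ⟨⟨ψ, h.mem_domain hE⟩, h0, IsConcentratedAt.apply_eq h hE hdense⟩⟩

/-! ### Detecting a jump on a countable dense set -/

/-- Spectral families have strong left limits: by `norm_proj_sub_proj_sq`, increments of `E(t) φ`
are controlled by those of the bounded monotone function `‖E(t) φ‖²`. -/
theorem exists_tendsto_proj (E : ResolutionOfIdentity H) {s : ℕ → ℝ} (hs : Monotone s) (φ : H) :
    ∃ η, Tendsto (fun k => E.proj (s k) φ) atTop (𝓝 η) := by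
  have hF : CauchySeq fun k => E.stieltjes φ (s k) := by
    refine (tendsto_atTop_ciSup ((E.stieltjes φ).mono.comp hs)
      ⟨‖φ‖ ^ 2, ?_⟩).cauchySeq
    rintro _ ⟨k, rfl⟩
    exact pow_le_pow_left₀ (norm_nonneg _) (E.norm_proj_apply_le _ _) 2
  refine cauchySeq_tendsto_of_complete (Metric.cauchySeq_iff'.2 fun ε hε => ?_)
  obtain ⟨N, hN⟩ := Metric.cauchySeq_iff'.1 hF (ε ^ 2) (by positivity)
  refine ⟨N, fun n hn => ?_⟩
  have h := (abs_lt.1 (hN n hn)).2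
  change ‖E.proj (s n) φ‖ ^ 2 - ‖E.proj (s N) φ‖ ^ 2 < ε ^ 2 at h
  rw [← E.norm_proj_sub_proj_sq (hs hn)] at h
  rw [dist_eq_norm]
  exact lt_of_pow_lt_pow_left₀ 2 hε.le h

/-- The spectral family has a nonzero vector concentrated at `e` exactly if it jumps at `e` on some
member of a given dense sequence; the left limit at `e` is taken along `s`. -/
theorem exists_isConcentratedAt_iff (E : ResolutionOfIdentity H) {e : ℝ} {s : ℕ → ℝ}
    (hs : Monotone s) (hlt : ∀ k, s k < e) (hlim : Tendsto s atTop (𝓝 e)) {d : ℕ → H}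
    (hd : DenseRange d) :
    (∃ ψ : H, ψ ≠ 0 ∧ E.IsConcentratedAt e ψ) ↔
      ∃ n, ¬ Tendsto (fun k => ‖E.proj e (d n)‖ ^ 2 - ‖E.proj (s k) (d n)‖ ^ 2)
        atTop (𝓝 0) := by
  constructor
  · rintro ⟨ψ, h0, hψ⟩
    by_contra! hall
    -- A concentrated vector is fixed by every `E(e) - E(s k)`, and these are bounded by `2`.
    have hstep : ∀ n, ‖ψ‖ ≤ 2 * ‖ψ - d n‖ := by
      intro n
      have h1 : Tendsto (fun k => ‖E.proj e (d n) - E.proj (s k) (d n)‖) atTop (𝓝 0) := by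
        have h := (hall n).sqrt
        rw [Real.sqrt_zero] at h
        refine h.congr fun k => ?_
        rw [← E.norm_proj_sub_proj_sq (hlt k).le, Real.sqrt_sq (norm_nonneg _)]
      have h2 := h1.const_add (2 * ‖ψ - d n‖)
      rw [add_zero] at h2
      refine ge_of_tendsto' h2 fun k => ?_
      have h3 : ψ = (E.proj e (ψ - d n) - E.proj (s k) (ψ - d n)) +
          (E.proj e (d n) - E.proj (s k) (d n)) := by
        rw [map_sub, map_sub, hψ.1 e le_rfl, hψ.2 _ (hlt k)]
        abel
      calc ‖ψ‖ ≤ ‖E.proj e (ψ - d n) - E.proj (s k) (ψ - d n)‖ +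
            ‖E.proj e (d n) - E.proj (s k) (d n)‖ := by
              conv_lhs => rw [h3]
              exact norm_add_le _ _
        _ ≤ _ := by
          gcongr
          have := norm_sub_le (E.proj e (ψ - d n)) (E.proj (s k) (ψ - d n))
          linarith [E.norm_proj_apply_le e (ψ - d n), E.norm_proj_apply_le (s k) (ψ - d n)]
    obtain ⟨n, hn⟩ := hd.exists_dist_lt ψ (ε := ‖ψ‖ / 2) (by positivity)
    rw [dist_eq_norm] at hn
    linarith [hstep n]
  · rintro ⟨n, hn⟩
    obtain ⟨η, hη⟩ := E.exists_tendsto_proj hs (d n)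
    refine ⟨E.proj e (d n) - η, fun h => hn ?_, fun t ht => ?_, fun t ht => ?_⟩
    · rw [sub_eq_zero] at h
      rw [← h] at hη
      have h' := (hη.norm.pow 2).const_sub (‖E.proj e (d n)‖ ^ 2)
      rwa [sub_self] at h'
    · rw [map_sub, proj_proj, min_eq_right ht]
      congr 1
      refine tendsto_nhds_unique (((E.proj t).continuous.tendsto η).comp hη) (hη.congr fun k => ?_)
      simp only [Function.comp_apply]
      rw [proj_proj, min_eq_right ((hlt k).le.trans ht)]
    · rw [map_sub, proj_proj, min_eq_left ht.le, sub_eq_zero]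
      refine tendsto_nhds_unique (tendsto_const_nhds.congr' ?_)
        (((E.proj t).continuous.tendsto η).comp hη)
      filter_upwards [hlim.eventually (eventually_ge_nhds ht)] with k hk
      simp only [Function.comp_apply]
      rw [proj_proj, min_eq_left hk]

end ResolutionOfIdentity

open ResolutionOfIdentity in
theorem mainTheorem10 {Ω H : Type*} [MeasurableSpace Ω] [NormedAddCommGroup H]
    [InnerProductSpace ℂ H] [CompleteSpace H] [TopologicalSpace.SeparableSpace H]
    (S : Ω → H →ₗ.[ℂ] H) (hS : ∀ ω, IsSelfAdjoint (S ω)) (hmeas : IsMeasurableFamily S)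
    (E : ℝ) :
    MeasurableSet {ω : Ω | (E : ℂ) ∈ pointSpectrum (S ω)} := by
  obtain ⟨R, hR, hRm⟩ := hmeas
  obtain ⟨s, hs, hlt, hlim⟩ := exists_seq_strictMono_tendsto E
  have hset : {ω : Ω | (E : ℂ) ∈ pointSpectrum (S ω)} =
      ⋃ n, {ω | Filter.Tendsto (fun k => ‖(R ω).proj E (TopologicalSpace.denseSeq H n)‖ ^ 2 -
        ‖(R ω).proj (s k) (TopologicalSpace.denseSeq H n)‖ ^ 2) Filter.atTop (nhds 0)}ᶜ := by
    ext ω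
    rw [Set.mem_ofPred_eq, (hR ω).mem_pointSpectrum_iff (hS ω).dense_domain,
      (R ω).exists_isConcentratedAt_iff hs.monotone hlt hlim
        (TopologicalSpace.denseRange_denseSeq H)]
    simp
  have hnorm : ∀ (t : ℝ) (φ : H), Measurable fun ω => ‖(R ω).proj t φ‖ ^ 2 := by
    intro t φ
    simp only [norm_proj_sq]
    exact Complex.measurable_re.comp (hRm t φ φ)
  rw [hset]
  exact MeasurableSet.iUnion fun n =>
    (measurableSet_tendsto _ fun k => (hnorm E _).sub (hnorm (s k) _)).compl
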